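/- Let $E_\rho$ be a universally complete Archimedean real vector lattice (Dedekind complete, and every nonempty set of pairwise disjoint positive elements has a supremum), equipped with an $f$-algebra multiplication with multiplicative identity $e$. Let $E=E_\rho\oplus iE_\rho$ be its complexification, with the canonically extended multiplication and the modulus $|f+ig|=\sup\{(\cos\theta)f+(\sin\theta)g:\theta\in[0,2\pi]\}$. A sequence $(x_n)_{n\ge0}$ in $E$ converges in order to $x\in E$, written $x_n\to x$, if there is a decreasing sequence $(p_n)_{n\ge0}$ in $E_\rho$ with $\inf_n p_n=0$ (written $p_n\downarrow0$) and $|x_n-x|\le p_n$ for all $n\ge0$. A series converges in order to $s$ if its partial sums do. For $x,y\in E_\rho$ write $x\ll y$ if $(y-x)^+$ is a weak order unit of $E_\rho$. For a power series $S(z)=\sum_{n=0}^\infty a_nz^n$ with $a_n\in E$ (where $z^0=e$), let $\Omega_S$ be the set of all $r\in E_\rho$, $r\ge0$, such that $S$ converges uniformly in order on $\{z\in E:|z|\le r\}$, i.e. there is a sequence $p_m\downarrow0$ with $\bigl|\sum_{n=0}^m a_nz^n-S(z)\bigr|\le p_m$ for all $m\ge0$ and all $z\in E$ with $|z|\le r$.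 If $\Omega_S$ is order bounded, $\sup\Omega_S$ is the radius of convergence of $S$. **Theorem (Abel).** Let $S(z)=\sum_{n=0}^\infty a_nz^n$ be a power series on $E$ with radius of convergence $e$, and suppose that $\sum_{n=0}^\infty a_n$ converges in order. Let $(z_k)_{k\ge0}$ be a sequence in $E$ such that 1. $z_k\to e$ in order, 2. $|z_k|\ll e$ for every $k\ge0$ (so that $e-|z_k|$ is invertible), and 3. the set $\{|e-z_k|\,(e-|z_k|)^{-1}:k\ge0\}$ is order bounded. Then $S(z_k)=\sum_{n=0}^\infty a_nz_k^n$ converges in order for every $k\ge0$, the series $S(e)=\sum_{n=0}^\infty a_ne^n$ converges in order, and $S(z_k)\to S(e)$ in order as $k\to\infty$. -/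

import Mathlib

/-- A universally complete Archimedean (real) `Φ`-algebra `A`.  The Dedekind completeness of `A`
(which implies that `A` is Archimedean) is carried by `ConditionallyCompleteLattice A`: every
nonempty set bounded above has a supremum, every nonempty set bounded below an infimum.
The fields say that `A` is an ordered vector space (hence, being a lattice, a vector lattice),
that its associative multiplication with identity `1` is an `f`-algebra multiplication, and that
`A` is laterally complete, i.e. every nonempty set of pairwise disjoint positive elements has a
supremum. Commutativity of the multiplication is not part of the definition. -/
class UnivCompletePhiAlgebra (A : Type*) [ConditionallyCompleteLattice A] [Ring A]
    [Algebra ℝ A] : Prop where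
  add_le_add_left' : ∀ x y : A, x ≤ y → ∀ z : A, z + x ≤ z + y
  smul_nonneg' : ∀ (t : ℝ) (x : A), 0 ≤ t → 0 ≤ x → 0 ≤ t • x
  mul_nonneg' : ∀ x y : A, 0 ≤ x → 0 ≤ y → 0 ≤ x * y
  mul_left_disjoint : ∀ x y w : A, 0 ≤ w → x ⊓ y = 0 → (w * x) ⊓ y = 0
  mul_right_disjoint : ∀ x y w : A, 0 ≤ w → x ⊓ y = 0 → (x * w) ⊓ y = 0
  laterally_complete : ∀ s : Set A, s.Nonempty → (∀ x ∈ s, 0 ≤ x) →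
    (∀ x ∈ s, ∀ y ∈ s, x ≠ y → x ⊓ y = 0) → ∃ b : A, IsLUB s b

/-- The vector space complexification `A ⊕ iA`; `⟨f, g⟩` is `f + ig`. -/
@[ext]
structure VLComplexification (A : Type*) where
  re : A
  im : A

namespace VLComplexification

section Algebraic

variable {A : Type*} [Ring A]

instance : Zero (VLComplexification A) := ⟨⟨0, 0⟩⟩
instance : One (VLComplexification A) := ⟨⟨1, 0⟩⟩
instance : Add (VLComplexification A) := ⟨fun z w => ⟨z.re + w.re, z.im + w.im⟩⟩
instance : Neg (VLComplexification A) := ⟨fun z => ⟨-z.re, -z.im⟩⟩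
/-- The canonical extension of the multiplication: `(a + ib)(c + id) = (ac - bd) + i(ad + bc)`. -/
instance : Mul (VLComplexification A) :=
  ⟨fun z w => ⟨z.re * w.re - z.im * w.im, z.re * w.im + z.im * w.re⟩⟩

@[simp] theorem zero_re : (0 : VLComplexification A).re = 0 := rfl
@[simp] theorem zero_im : (0 : VLComplexification A).im = 0 := rfl
@[simp] theorem one_re : (1 : VLComplexification A).re = 1 := rfl
@[simp] theorem one_im : (1 : VLComplexification A).im = 0 := rfl
@[simp] theorem add_re (z w : VLComplexification A) : (z + w).re = z.re + w.re := rfl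
@[simp] theorem add_im (z w : VLComplexification A) : (z + w).im = z.im + w.im := rfl
@[simp] theorem neg_re (z : VLComplexification A) : (-z).re = -z.re := rfl
@[simp] theorem neg_im (z : VLComplexification A) : (-z).im = -z.im := rfl
@[simp] theorem mul_re (z w : VLComplexification A) :
    (z * w).re = z.re * w.re - z.im * w.im := rfl
@[simp] theorem mul_im (z w : VLComplexification A) :
    (z * w).im = z.re * w.im + z.im * w.re := rfl

instance : Ring (VLComplexification A) where
  add_assoc x y z := by ext <;> simp [add_assoc]
  zero_add x := by ext <;> simp
  add_zero x := by ext <;> simp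
  add_comm x y := by ext <;> simp [add_comm]
  neg_add_cancel x := by ext <;> simp
  mul_assoc x y z := by ext <;> simp <;> noncomm_ring
  one_mul x := by ext <;> simp
  mul_one x := by ext <;> simp
  zero_mul x := by ext <;> simp
  mul_zero x := by ext <;> simp
  left_distrib x y z := by ext <;> simp <;> noncomm_ring
  right_distrib x y z := by ext <;> simp <;> noncomm_ring
  nsmul := nsmulRec
  zsmul := zsmulRec

@[simp] theorem sub_re (z w : VLComplexification A) : (z - w).re = z.re - w.re := by
  simp [sub_eq_add_neg]
@[simp] theorem sub_im (z w : VLComplexification A) : (z - w).im = z.im - w.im := by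
  simp [sub_eq_add_neg]

variable [Algebra ℝ A]

/-- `(s + it)(f + ig) = (sf - tg) + i(sg + tf)`. -/
instance : SMul ℂ (VLComplexification A) :=
  ⟨fun c z => ⟨c.re • z.re - c.im • z.im, c.re • z.im + c.im • z.re⟩⟩

@[simp] theorem smul_re (c : ℂ) (z : VLComplexification A) :
    (c • z).re = c.re • z.re - c.im • z.im := rfl
@[simp] theorem smul_im (c : ℂ) (z : VLComplexification A) :
    (c • z).im = c.re • z.im + c.im • z.re := rfl

instance : Module ℂ (VLComplexification A) where
  one_smul x := by ext <;> simp
  mul_smul c d x := by ext <;> simp <;> module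
  smul_zero c := by ext <;> simp
  smul_add c x y := by ext <;> simp <;> module
  add_smul c d x := by ext <;> simp <;> module
  zero_smul x := by ext <;> simp

end Algebraic

variable {A : Type*} [ConditionallyCompleteLattice A] [Ring A] [Algebra ℝ A]

/-- The modulus `|f + ig| = sup {(cos θ) f + (sin θ) g : θ ∈ [0, 2π]}`, a positive element of the
real part `A`. -/
noncomputable def modulus (z : VLComplexification A) : A :=
  sSup ((fun θ : ℝ => Real.cos θ • z.re + Real.sin θ • z.im) '' Set.Icc 0 (2 * Real.pi))

/-- The supremum defining the modulus is a genuine one. -/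
theorem isLUB_modulus [UnivCompletePhiAlgebra A] (z : VLComplexification A) :
    IsLUB ((fun θ : ℝ => Real.cos θ • z.re + Real.sin θ • z.im) '' Set.Icc 0 (2 * Real.pi))
      (modulus z) := by
  have : IsOrderedAddMonoid A :=
    { add_le_add_left := fun x y h c => by
        simpa [add_comm] using UnivCompletePhiAlgebra.add_le_add_left' x y h c }
  have key : ∀ (t : ℝ) (x : A), -1 ≤ t → t ≤ 1 → t • x ≤ |x| := by
    intro t x h1 h2
    have e1 := UnivCompletePhiAlgebra.smul_nonneg' ((1 + t) / 2) (|x| - x) (by linarith)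
      (sub_nonneg.2 (le_abs_self x))
    have e2 := UnivCompletePhiAlgebra.smul_nonneg' ((1 - t) / 2) (|x| + x) (by linarith)
      (by simpa [sub_neg_eq_add] using sub_nonneg.2 (neg_le_abs x))
    have e3 := add_nonneg e1 e2
    have e4 : ((1 + t) / 2) • (|x| - x) + ((1 - t) / 2) • (|x| + x) = |x| - t • x := by module
    rw [e4] at e3
    exact sub_nonneg.1 e3
  refine isLUB_csSup ⟨_, 0, ⟨le_refl _, by positivity⟩, rfl⟩ ⟨|z.re| + |z.im|, ?_⟩
  rintro _ ⟨θ, -, rfl⟩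
  exact add_le_add (key _ _ (Real.neg_one_le_cos θ) (Real.cos_le_one θ))
    (key _ _ (Real.neg_one_le_sin θ) (Real.sin_le_one θ))

end VLComplexification

section OrderNotions

variable {A : Type*} [ConditionallyCompleteLattice A] [Ring A] [Algebra ℝ A]

/-- `p_n ↓ 0`: the sequence `p` is decreasing with infimum `0`. -/
def DecreasesToZero (p : ℕ → A) : Prop :=
  Antitone p ∧ IsGLB (Set.range p) 0

/-- Order convergence `x_n → x`: there is `p_n ↓ 0` with `|x_n - x| ≤ p_n` for all `n`. -/
def OrderTendsto (x : ℕ → VLComplexification A) (l : VLComplexification A) : Prop :=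
  ∃ p : ℕ → A, DecreasesToZero p ∧ ∀ n, (x n - l).modulus ≤ p n

/-- The series `∑ a_n` converges in order with sum `s`. -/
def HasOrderSum (a : ℕ → VLComplexification A) (s : VLComplexification A) : Prop :=
  OrderTendsto (fun m => ∑ n ∈ Finset.range (m + 1), a n) s

/-- `u` is a weak order unit: `u ≥ 0`, and only `0` is disjoint from `u`. -/
def IsWeakOrderUnit (u : A) : Prop :=
  0 ≤ u ∧ ∀ x : A, u ⊓ |x| = 0 → x = 0

/-- `x ≪ y`: the positive part `(y - x)⁺` is a weak order unit. -/
def OrderLL (x y : A) : Prop :=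
  IsWeakOrderUnit ((y - x) ⊔ 0)

/-- A set is order bounded if it is contained in an order interval. -/
def OrderBounded (s : Set A) : Prop :=
  ∃ l u : A, s ⊆ Set.Icc l u

/-- The power series `∑ a_n z^n` converges uniformly in order on `D`: for some `p_m ↓ 0` and some
sum function `S` on `D`, `|∑_{n ≤ m} a_n z^n - S z| ≤ p_m` for all `m` and all `z ∈ D`. -/
def ConvergesUniformlyInOrderOn (a : ℕ → VLComplexification A)
    (D : Set (VLComplexification A)) : Prop :=
  ∃ (S : VLComplexification A → VLComplexification A) (p : ℕ → A), DecreasesToZero p ∧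
    ∀ m, ∀ z ∈ D, (∑ n ∈ Finset.range (m + 1), a n * z ^ n - S z).modulus ≤ p m

/-- The set `Ω_S` of those `r ≥ 0` such that `∑ a_n z^n` converges uniformly in order on the order
closed ball `{z : |z| ≤ r}`. -/
def uniformConvergenceRadii (a : ℕ → VLComplexification A) : Set A :=
  {r | 0 ≤ r ∧ ConvergesUniformlyInOrderOn a {z | z.modulus ≤ r}}

/-- `ρ` is the radius of convergence of `∑ a_n z^n`: `Ω_S` is order bounded and `ρ = sup Ω_S`. -/
def IsRadiusOfConvergence (a : ℕ → VLComplexification A) (ρ : A) : Prop :=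
  IsLUB (uniformConvergenceRadii a) ρ

end OrderNotions

/-! Abel's classical proof works once two facts about `A` are available: the modulus is
submultiplicative, and for `w = |z_k|` the geometric series of `w` is order bounded with sum `(1 -
w)⁻¹`. Write `A_n` for the partial sums of the coefficients, `s` for their limit and `|A_n - s| ≤ p
n`. Summation by parts turns `∑ a_n z^n - s` into `∑ (A_n - s)(1 - z) z^n` plus a boundary term.
Splitting at `m` and letting the upper limit tend to infinity gives `|S(z_k) - s| ≤ m • (p 0 * |1 -
z_k|) + p m * M`, where `M` bounds the set in hypothesis 3. Let `k`, then `m`, tend to infinity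
(`orderTendsto_of_modulus_le`). The series at `z_k` converges by comparison with `B * w ^ n`, where
`B` bounds the `|a_n|`.

Submultiplicativity (`re_mul_le`) comes from rotating `z` and `w` in opposite directions. No angle
makes the rotated `w` real and positive everywhere at once, so a discrete intermediate value
argument replaces the choice of an angle.

The geometric series (`exists_forall_geom_sum_le`) is bounded by cutting `1` into disjoint pieces on
which `1 - w` is bounded below, and gluing the bounds by lateral completeness. -/

section LatticeOrderedGroup

/-! ### A discrete intermediate value theorem in lattice-ordered groups. -/

variable {G : Type*} [Lattice G] [AddCommGroup G] [IsOrderedAddMonoid G]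

theorem inf_add_le_add_inf {t a b : G} (ht : 0 ≤ t) (ha : 0 ≤ a) (hb : 0 ≤ b) :
    t ⊓ (a + b) ≤ t ⊓ a + t ⊓ b := by
  rw [inf_add, add_inf t b a]
  refine le_inf (inf_le_left.trans (le_add_of_nonneg_right (le_inf ht hb))) (le_inf ?_ inf_le_right)
  exact inf_le_left.trans (le_add_of_nonneg_left ha)

/-- A drop from positive to negative costs at most `t`: `a⁺ ≤ b⁺ + t`, and `b⁺` is disjoint from
`b⁻`. -/
theorem posPart_inf_negPart_le_of_le_add {a b t : G} (ht : 0 ≤ t) (h : a ≤ b + t) :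
    a⁺ ⊓ b⁻ ≤ t := by
  have h1 : a⁺ ≤ b⁺ + t :=
    sup_le (h.trans (add_le_add_left (le_posPart b) t)) (add_nonneg (posPart_nonneg b) ht)
  calc a⁺ ⊓ b⁻ ≤ b⁻ ⊓ (b⁺ + t) := le_inf inf_le_right (inf_le_left.trans h1)
    _ ≤ b⁻ ⊓ b⁺ + b⁻ ⊓ t :=
        inf_add_le_add_inf (negPart_nonneg b) (posPart_nonneg b) ht
    _ ≤ 0 + t := by
        refine add_le_add ?_ inf_le_right
        rw [inf_comm, posPart_inf_negPart_eq_zero]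
    _ = t := zero_add t

/-- A discrete intermediate value theorem: a finite sequence with steps bounded by `t` whose last
element is the negative of the first cannot be uniformly larger than `t` in modulus. -/
theorem le_of_le_abs_of_abs_sub_le {x : ℕ → G} {q t : G} {N : ℕ} (ht : 0 ≤ t)
    (hstep : ∀ j, |x (j + 1) - x j| ≤ t) (hend : x N = -x 0) (hq : ∀ j, q ≤ |x j|) : q ≤ t := by
  have dist : ∀ a b c : G, a ⊓ (b ⊔ c) = (a ⊓ b) ⊔ (a ⊓ c) :=
    fun a b c => by
      let := AddCommGroup.toDistribLattice G
      exact inf_sup_left a b c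
  have abs_eq : ∀ y : G, |y| = y⁺ ⊔ y⁻ := fun y => by
    have := inf_add_sup y⁺ y⁻
    rw [posPart_inf_negPart_eq_zero, zero_add, posPart_add_negPart] at this
    exact this.symm
  -- Invariant: apart from `t`, `q` is controlled by the part where `x k` still has the sign of `x
  -- 0`, since a change of sign in one step is only possible below `t`. At `k = N` all signs are
  -- reversed, so only `t` is left.
  have key : ∀ k, q ≤ t ⊔ ((x 0)⁺ ⊓ (x k)⁺ ⊔ (x 0)⁻ ⊓ (x k)⁻) := by
    intro k
    induction k with
    | zero =>
      simpa only [inf_idem, ← abs_eq] using (hq 0).trans le_sup_right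
    | succ k ih =>
      have hq' : q ≤ (x (k + 1))⁺ ⊔ (x (k + 1))⁻ := abs_eq (x (k + 1)) ▸ hq (k + 1)
      have h1 : x k ≤ x (k + 1) + t := by
        have := (neg_le_abs _).trans (hstep k)
        rw [neg_sub] at this
        exact sub_le_iff_le_add'.1 this
      have h2 : x (k + 1) ≤ x k + t := sub_le_iff_le_add'.1 ((le_abs_self _).trans (hstep k))
      have h3 := posPart_inf_negPart_le_of_le_add ht h1
      have h4 := posPart_inf_negPart_le_of_le_add ht h2
      refine (le_inf ih hq').trans ?_
      rw [inf_comm, dist]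
      refine sup_le (inf_le_right.trans le_sup_left) ?_
      rw [dist]
      refine sup_le ?_ ?_ <;> rw [inf_comm, dist] <;> refine sup_le ?_ ?_
      · refine le_sup_of_le_right (le_sup_of_le_left ?_)
        exact le_inf (inf_le_left.trans inf_le_left) inf_le_right
      · exact le_sup_of_le_left (le_trans (le_inf (inf_le_left.trans inf_le_right) inf_le_right) h3)
      · exact le_sup_of_le_left (le_trans (le_inf inf_le_right (inf_le_left.trans inf_le_right)) h4)
      · refine le_sup_of_le_right (le_sup_of_le_right ?_)
        exact le_inf (inf_le_left.trans inf_le_left) inf_le_right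
  have hN := key N
  rw [hend, posPart_neg, negPart_neg, posPart_inf_negPart_eq_zero, inf_comm,
    posPart_inf_negPart_eq_zero, sup_idem, sup_of_le_left ht] at hN
  exact hN

end LatticeOrderedGroup

/-! ### Order and multiplication in the real algebra. -/

namespace UnivCompletePhiAlgebra

theorem inf_eq_zero_of_le {G : Type*} [SemilatticeInf G] [Zero G] {x y x' y' : G} (h : x ⊓ y = 0) (hx0 : 0 ≤ x') (hy0 : 0 ≤ y')
    (hx : x' ≤ x) (hy : y' ≤ y) : x' ⊓ y' = 0 :=
  le_antisymm ((inf_le_inf hx hy).trans h.le) (le_inf hx0 hy0)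

variable {A : Type*} [ConditionallyCompleteLattice A] [Ring A] [Algebra ℝ A]
  [UnivCompletePhiAlgebra A]

theorem toIsOrderedAddMonoid (A : Type*) [ConditionallyCompleteLattice A] [Ring A] [Algebra ℝ A]
    [UnivCompletePhiAlgebra A] : IsOrderedAddMonoid A where
  add_le_add_left x y h c := by
    simpa [add_comm] using add_le_add_left' x y h c

/-- Multiplying one factor at a time keeps disjointness: `x * y` is disjoint from `y`, hence from `x
* y` itself. -/
theorem mul_eq_zero_of_inf_eq_zero {x y : A} (h : x ⊓ y = 0) : x * y = 0 := by
  have hx : 0 ≤ x := h ▸ inf_le_left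
  have hy : 0 ≤ y := h ▸ inf_le_right
  have h1 := mul_right_disjoint x y y hy h
  have h2 := mul_left_disjoint y (x * y) x hx (by rw [inf_comm]; exact h1)
  rwa [inf_idem] at h2

/-- Since `1⁻ * 1⁺ = 0`, expanding `1⁻ * 1` gives `1⁻ = -(1⁻ * 1⁻) ≤ 0`. -/
theorem zero_le_one' : (0 : A) ≤ 1 := by
  have := toIsOrderedAddMonoid A
  have h1 : (1 : A)⁻ * 1⁺ = 0 :=
    mul_eq_zero_of_inf_eq_zero (by rw [inf_comm]; exact posPart_inf_negPart_eq_zero _)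
  have h2 : (1 : A)⁻ = -(1⁻ * 1⁻) := by
    calc (1 : A)⁻ = 1⁻ * 1 := (mul_one _).symm
      _ = 1⁻ * (1⁺ - 1⁻) := by rw [posPart_sub_negPart]
      _ = -(1⁻ * 1⁻) := by rw [mul_sub, h1, zero_sub]
  have h3 : (1 : A)⁻ ≤ 0 := by
    rw [h2]
    exact neg_nonpos.2 (mul_nonneg' _ _ (negPart_nonneg _) (negPart_nonneg _))
  exact negPart_eq_zero.1 (le_antisymm h3 (negPart_nonneg _))

instance (priority := 100) toIsOrderedRing : IsOrderedRing A :=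
  have := toIsOrderedAddMonoid A
  have : ZeroLEOneClass A := ⟨zero_le_one'⟩
  IsOrderedRing.of_mul_nonneg mul_nonneg'

instance (priority := 100) toPosSMulMono : PosSMulMono ℝ A :=
  PosSMulMono.of_smul_nonneg fun t ht x hx => smul_nonneg' t x ht hx

theorem smul_le_smul_abs {t r : ℝ} (h : |t| ≤ r) (x : A) : t • x ≤ r • |x| := by
  obtain ⟨h1, h2⟩ := abs_le.1 h
  have e1 := smul_nonneg' ((r + t) / 2) (|x| - x) (by linarith) (sub_nonneg.2 (le_abs_self x))
  have e2 := smul_nonneg' ((r - t) / 2) (|x| + x) (by linarith)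
    (by simpa [sub_neg_eq_add] using sub_nonneg.2 (neg_le_abs x))
  have e3 := add_nonneg e1 e2
  have e4 : ((r + t) / 2) • (|x| - x) + ((r - t) / 2) • (|x| + x) = r • |x| - t • x := by module
  rw [e4] at e3
  exact sub_nonneg.1 e3

/-- The Archimedean property from Dedekind completeness: the supremum `s` of the multiples of `y`
satisfies `s ≤ s - y`. -/
theorem nonpos_of_forall_nsmul_le {y c : A} (h : ∀ n : ℕ, n • y ≤ c) : y ≤ 0 := by
  have hb : BddAbove (Set.range fun n : ℕ => n • y) := ⟨c, by rintro _ ⟨n, rfl⟩; exact h n⟩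
  have hl := isLUB_csSup (Set.range_nonempty _) hb
  set s := sSup (Set.range fun n : ℕ => n • y)
  have : s ≤ s - y := by
    refine hl.2 ?_
    rintro _ ⟨n, rfl⟩
    have := hl.1 ⟨n + 1, rfl⟩
    simp only [succ_nsmul] at this
    exact le_sub_iff_add_le.2 this
  simpa using this

theorem nonpos_of_forall_le_smul {y c : A} (h : ∀ n : ℕ, y ≤ ((n : ℝ) + 1)⁻¹ • c) : y ≤ 0 := by
  have hn : ∀ n : ℕ, (n + 1) • y ≤ c := fun n => by
    have h0 : (0 : ℝ) < (n : ℝ) + 1 := by positivity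
    have := smul_le_smul_of_nonneg_left (h n) h0.le
    rw [smul_smul, mul_inv_cancel₀ h0.ne', one_smul] at this
    have e : ((n : ℝ) + 1) • y = (n + 1) • y := by
      rw [← Nat.cast_smul_eq_nsmul ℝ]; push_cast; rfl
    rwa [e] at this
  refine nonpos_of_forall_nsmul_le (c := c ⊔ 0) fun n => ?_
  cases n with
  | zero => simp
  | succ n => exact (hn n).trans le_sup_left

/-- `w * x⁺` and `w * x⁻` are disjoint, so the modulus of their difference is their sum. -/
theorem abs_mul_of_nonneg_left {w : A} (hw : 0 ≤ w) (x : A) : |w * x| = w * |x| := by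
  have h1 : (w * x⁺) ⊓ x⁻ = 0 := mul_left_disjoint _ _ w hw (posPart_inf_negPart_eq_zero x)
  have h2 : (w * x⁻) ⊓ (w * x⁺) = 0 := mul_left_disjoint _ _ w hw (by rw [inf_comm]; exact h1)
  have h3 := inf_add_sup (w * x⁻) (w * x⁺)
  have h4 := sup_sub_inf_eq_abs_sub (w * x⁻) (w * x⁺)
  rw [h2, zero_add] at h3
  rw [h2, sub_zero, h3, add_comm, ← mul_add, posPart_add_negPart, ← mul_sub,
    posPart_sub_negPart] at h4
  exact h4.symm

end UnivCompletePhiAlgebra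

/-! ### The modulus and its submultiplicativity. -/

namespace VLComplexification

open UnivCompletePhiAlgebra

section AlgebraLemmas

variable {A : Type*} [Ring A]

theorem re_sum {ι : Type*} (s : Finset ι) (f : ι → VLComplexification A) :
    (∑ i ∈ s, f i).re = ∑ i ∈ s, (f i).re := by
  classical
  induction s using Finset.induction_on with
  | empty => simp
  | insert i s hi ih => simp [Finset.sum_insert hi, ih]

theorem im_sum {ι : Type*} (s : Finset ι) (f : ι → VLComplexification A) :
    (∑ i ∈ s, f i).im = ∑ i ∈ s, (f i).im := by
  classical
  induction s using Finset.induction_on with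
  | empty => simp
  | insert i s hi ih => simp [Finset.sum_insert hi, ih]

/-- The real part of `z * w` is unchanged when `z` and `w` are rotated in opposite directions. -/
theorem re_mul_eq_rotate [Algebra ℝ A] (z w : VLComplexification A) (θ : ℝ) :
    (z * w).re = (Real.cos θ • z.re + Real.sin θ • z.im) *
        (Real.cos θ • w.re + (-Real.sin θ) • w.im) -
      (Real.cos θ • z.im + (-Real.sin θ) • z.re) * (Real.cos θ • w.im + Real.sin θ • w.re) := by
  have h : Real.cos θ * Real.cos θ = 1 - Real.sin θ * Real.sin θ := by
    have := Real.sin_sq_add_cos_sq θ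
    linarith
  simp only [mul_re, add_mul, mul_add, smul_mul_smul_comm, h]
  module

end AlgebraLemmas

variable {A : Type*} [ConditionallyCompleteLattice A] [Ring A] [Algebra ℝ A]
  [UnivCompletePhiAlgebra A]

theorem rotate_le_modulus (z : VLComplexification A) (θ : ℝ) :
    Real.cos θ • z.re + Real.sin θ • z.im ≤ z.modulus := by
  have h := toIcoMod_mem_Ico Real.two_pi_pos 0 θ
  rw [zero_add] at h
  refine (isLUB_modulus z).1 ⟨_, ⟨h.1, h.2.le⟩, ?_⟩
  simp only [toIcoMod, zsmul_eq_mul, Real.cos_sub_int_mul_two_pi, Real.sin_sub_int_mul_two_pi]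

theorem modulus_le_iff {z : VLComplexification A} {b : A} :
    z.modulus ≤ b ↔ ∀ θ : ℝ, Real.cos θ • z.re + Real.sin θ • z.im ≤ b := by
  refine ⟨fun h θ => (rotate_le_modulus z θ).trans h, fun h => (isLUB_modulus z).2 ?_⟩
  rintro _ ⟨θ, -, rfl⟩
  exact h θ

theorem abs_rotate_le_modulus (z : VLComplexification A) (θ : ℝ) :
    |Real.cos θ • z.re + Real.sin θ • z.im| ≤ z.modulus := by
  refine abs_le'.2 ⟨rotate_le_modulus z θ, ?_⟩
  have := rotate_le_modulus z (θ + Real.pi)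
  rw [Real.cos_add_pi, Real.sin_add_pi, neg_smul, neg_smul, ← neg_add] at this
  exact this

theorem abs_re_le_modulus (z : VLComplexification A) : |z.re| ≤ z.modulus := by
  simpa using abs_rotate_le_modulus z 0

theorem abs_im_le_modulus (z : VLComplexification A) : |z.im| ≤ z.modulus := by
  simpa using abs_rotate_le_modulus z (Real.pi / 2)

theorem modulus_nonneg (z : VLComplexification A) : 0 ≤ z.modulus :=
  (abs_nonneg _).trans (abs_re_le_modulus z)

theorem modulus_le_abs_add_abs (z : VLComplexification A) : z.modulus ≤ |z.re| + |z.im| := by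
  refine modulus_le_iff.2 fun θ => add_le_add ?_ ?_
  · simpa using smul_le_smul_abs (Real.abs_cos_le_one θ) z.re
  · simpa using smul_le_smul_abs (Real.abs_sin_le_one θ) z.im

theorem modulus_zero : (0 : VLComplexification A).modulus = 0 :=
  le_antisymm (modulus_le_iff.2 fun θ => by simp) (modulus_nonneg _)

theorem modulus_one_le : (1 : VLComplexification A).modulus ≤ 1 := by
  refine (modulus_le_abs_add_abs _).trans ?_
  simp [abs_of_nonneg (zero_le_one' (A := A))]

theorem modulus_neg (z : VLComplexification A) : (-z).modulus = z.modulus := by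
  have h : ∀ w : VLComplexification A, (-w).modulus ≤ w.modulus := fun w =>
    modulus_le_iff.2 fun θ => by
      have := (neg_le_abs _).trans (abs_rotate_le_modulus w θ)
      rw [neg_add, ← smul_neg, ← smul_neg] at this
      exact this
  refine le_antisymm (h z) ?_
  simpa using h (-z)

theorem modulus_sub_comm (z w : VLComplexification A) : (z - w).modulus = (w - z).modulus := by
  rw [← modulus_neg, neg_sub]

theorem modulus_add_le (z w : VLComplexification A) :
    (z + w).modulus ≤ z.modulus + w.modulus := by
  refine modulus_le_iff.2 fun θ => ?_
  refine le_trans (le_of_eq ?_) (add_le_add (rotate_le_modulus z θ) (rotate_le_modulus w θ))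
  simp only [add_re, add_im]
  module

theorem modulus_sub_le (z w : VLComplexification A) :
    (z - w).modulus ≤ z.modulus + w.modulus := by
  rw [sub_eq_add_neg, ← modulus_neg w]
  exact modulus_add_le _ _

theorem modulus_sum_le {ι : Type*} (s : Finset ι) (f : ι → VLComplexification A) :
    (∑ i ∈ s, f i).modulus ≤ ∑ i ∈ s, (f i).modulus := by
  classical
  induction s using Finset.induction_on with
  | empty => simp [modulus_zero]
  | insert i s hi ih =>
    rw [Finset.sum_insert hi, Finset.sum_insert hi]
    exact (modulus_add_le _ _).trans (add_le_add_right ih _)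

/-- Rotating `z` by `-θ` and `w` by `θ` shows that `(z * w).re - |z| * |w|` is at most `|z| * |Im
(e^{iθ} w)|` for every `θ`. As `θ` runs from `0` to `π` in small steps, `Im (e^{iθ} w)` turns into
its negative, so the discrete intermediate value theorem bounds the difference by the step size,
which is arbitrarily small. -/
theorem re_mul_le (z w : VLComplexification A) : (z * w).re ≤ z.modulus * w.modulus := by
  refine sub_nonpos.1 (nonpos_of_forall_le_smul (c := Real.pi • (z.modulus * (|w.im| + |w.re|)))
    fun n => ?_)
  have hn : (0 : ℝ) < (n : ℝ) + 1 := by positivity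
  have hδ : 0 ≤ Real.pi / ((n : ℝ) + 1) := by positivity
  set δ : ℝ := Real.pi / ((n : ℝ) + 1) with hδ_def
  have hz := modulus_nonneg z
  have hC : 0 ≤ z.modulus * (|w.im| + |w.re|) :=
    mul_nonneg hz (add_nonneg (abs_nonneg _) (abs_nonneg _))
  have := le_of_le_abs_of_abs_sub_le (q := (z * w).re - z.modulus * w.modulus)
    (t := δ • (z.modulus * (|w.im| + |w.re|))) (N := n + 1)
    (x := fun j => z.modulus * (Real.cos (j * δ) • w.im + Real.sin (j * δ) • w.re))
    (smul_nonneg hδ hC) ?_ ?_ ?_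
  · refine this.trans (le_of_eq ?_)
    rw [smul_smul, hδ_def, div_eq_inv_mul]
  · intro j
    have hj : |((j + 1 : ℕ) : ℝ) * δ - j * δ| ≤ δ := by
      push_cast
      rw [add_mul, add_sub_cancel_left, one_mul, abs_of_nonneg hδ]
    have hc := (Real.abs_cos_sub_cos_le (((j + 1 : ℕ) : ℝ) * δ) (j * δ)).trans hj
    have hs := (Real.abs_sin_sub_sin_le (((j + 1 : ℕ) : ℝ) * δ) (j * δ)).trans hj
    have key : ∀ (t : ℝ) (x : A), |t| ≤ δ → |t • x| ≤ δ • |x| := fun t x ht =>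
      abs_le'.2 ⟨smul_le_smul_abs ht x, by
        rw [← neg_smul]; exact smul_le_smul_abs (by rwa [abs_neg]) x⟩
    rw [← mul_sub, abs_mul_of_nonneg_left hz, ← mul_smul_comm]
    refine mul_le_mul_of_nonneg_left ?_ hz
    rw [add_sub_add_comm, ← sub_smul, ← sub_smul, smul_add]
    exact (abs_add_le _ _).trans (add_le_add (key _ _ hc) (key _ _ hs))
  · have hπ : ((n + 1 : ℕ) : ℝ) * δ = Real.pi := by
      push_cast
      rw [hδ_def]
      field_simp
    simp only [hπ]
    simp
  · intro j
    rw [abs_mul_of_nonneg_left hz, sub_le_iff_le_add, add_comm,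
      re_mul_eq_rotate z w (j * δ), sub_eq_add_neg]
    have e1 : ∀ (u : VLComplexification A) (φ : ℝ),
        |Real.cos φ • u.re + (-Real.sin φ) • u.im| ≤ u.modulus := fun u φ => by
      simpa using abs_rotate_le_modulus u (-φ)
    have e2 : |-(Real.cos (j * δ) • z.im + (-Real.sin (j * δ)) • z.re)| ≤ z.modulus := by
      refine le_trans (le_of_eq ?_) (abs_rotate_le_modulus z (j * δ + Real.pi / 2))
      rw [abs_neg, Real.cos_add_pi_div_two, Real.sin_add_pi_div_two, add_comm]
    -- `m * |y| - x * y` is the sum of the positive elements `(m - x) * y⁺` and `(m + x) * y⁻`.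
    have mul_le : ∀ x y m : A, |x| ≤ m → x * y ≤ m * |y| := fun x y m hx => by
      have hm := (abs_nonneg x).trans hx
      have h1 : 0 ≤ (m - x) * y⁺ := mul_nonneg (sub_nonneg.2 ((le_abs_self x).trans hx))
        (posPart_nonneg y)
      have h2 : 0 ≤ (m + x) * y⁻ := mul_nonneg
        (by simpa using sub_nonneg.2 ((neg_le_abs x).trans hx)) (negPart_nonneg y)
      have h3 := add_nonneg h1 h2
      have h4 : (m - x) * y⁺ + (m + x) * y⁻ = m * (y⁺ + y⁻) - x * (y⁺ - y⁻) := by noncomm_ring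
      rw [h4, posPart_add_negPart, posPart_sub_negPart] at h3
      exact sub_nonneg.1 h3
    refine add_le_add ?_ ?_
    · exact (mul_le _ _ _ (abs_rotate_le_modulus z _)).trans
        (mul_le_mul_of_nonneg_left (e1 w _) hz)
    · rw [← neg_mul]
      exact mul_le _ _ _ e2

/-- Each rotated real part of `z * w` is the real part of `(e^{-iθ} z) * w`, and rotation does not
increase the modulus. -/
theorem modulus_mul_le (z w : VLComplexification A) :
    (z * w).modulus ≤ z.modulus * w.modulus := by
  refine modulus_le_iff.2 fun θ => ?_
  let c : ℂ := ⟨Real.cos θ, -Real.sin θ⟩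
  have hc : (c • z).modulus ≤ z.modulus := by
    refine modulus_le_iff.2 fun φ => ?_
    refine le_trans (le_of_eq ?_) (rotate_le_modulus z (θ + φ))
    rw [Real.cos_add, Real.sin_add]
    simp only [smul_re, smul_im, c]
    module
  refine le_trans (le_of_eq ?_) ((re_mul_le (c • z) w).trans
    (mul_le_mul_of_nonneg_right hc (modulus_nonneg w)))
  simp only [mul_re, mul_im, smul_re, smul_im, c, sub_mul, add_mul, smul_mul_assoc]
  module

theorem modulus_pow_le (z : VLComplexification A) (n : ℕ) : (z ^ n).modulus ≤ z.modulus ^ n := by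
  induction n with
  | zero => simpa using modulus_one_le
  | succ n ih =>
    rw [pow_succ, pow_succ]
    exact (modulus_mul_le _ _).trans (mul_le_mul_of_nonneg_right ih (modulus_nonneg z))

end VLComplexification

/-! ### Components of the unit, the geometric series and the inverse of `1 - w`. -/

namespace UnivCompletePhiAlgebra

section

variable {A : Type*} [ConditionallyCompleteLattice A] [Ring A]

/-- The component of `1` in the band generated by `y`. -/
noncomputable def unitComponent (y : A) : A :=
  sSup (Set.range fun k : ℕ => k • y ⊓ 1)

theorem isLUB_unitComponent (y : A) :
    IsLUB (Set.range fun k : ℕ => k • y ⊓ 1) (unitComponent y) :=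
  isLUB_csSup (Set.range_nonempty _) ⟨1, by rintro _ ⟨k, rfl⟩; exact inf_le_right⟩

theorem unitComponent_le_one (y : A) : unitComponent y ≤ 1 :=
  (isLUB_unitComponent y).2 (by rintro _ ⟨k, rfl⟩; exact inf_le_right)

end

variable {A : Type*} [ConditionallyCompleteLattice A] [Ring A] [Algebra ℝ A]
  [UnivCompletePhiAlgebra A]

/-- By disjointness `f n + e ⊓ c` is the supremum of its two terms, so it is at most `e`; thus `e -
e ⊓ c` is again an upper bound of `f`. -/
theorem inf_eq_zero_of_isLUB {f : ℕ → A} {e c : A} (he : IsLUB (Set.range f) e) (he0 : 0 ≤ e)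
    (hc : 0 ≤ c) (h : ∀ n, f n ⊓ c = 0) : e ⊓ c = 0 := by
  refine le_antisymm ?_ (le_inf he0 hc)
  have : e ≤ e - e ⊓ c := by
    refine he.2 ?_
    rintro _ ⟨n, rfl⟩
    have h1 := inf_add_sup (f n) (e ⊓ c)
    have h2 : f n ⊓ (e ⊓ c) ≤ 0 := (inf_le_inf_left _ inf_le_right).trans (h n).le
    have h3 : f n ⊔ e ⊓ c ≤ e := sup_le (he.1 ⟨n, rfl⟩) inf_le_left
    have h4 : f n + e ⊓ c ≤ 0 + e := h1 ▸ add_le_add h2 h3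
    rw [zero_add] at h4
    exact le_sub_iff_add_le.2 h4
  simpa using this

theorem nsmul_inf_eq_zero {x y : A} (h : x ⊓ y = 0) (n : ℕ) : (n • x) ⊓ y = 0 := by
  rw [nsmul_eq_mul]
  exact mul_left_disjoint _ _ _ (Nat.cast_nonneg n) h

/-- A sum of disjoint positive elements is their supremum. -/
theorem sum_le_of_pairwise_inf_eq_zero {x : ℕ → A} {b : A} (hx : ∀ n, 0 ≤ x n) (hb : 0 ≤ b)
    (hxb : ∀ n, x n ≤ b) (h : ∀ m n, m < n → x m ⊓ x n = 0) (K : ℕ) :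
    ∑ n ∈ Finset.range K, x n ≤ b := by
  have hs : ∀ K, 0 ≤ ∑ n ∈ Finset.range K, x n := fun K => Finset.sum_nonneg fun n _ => hx n
  have key : ∀ K m, K ≤ m → x m ⊓ ∑ n ∈ Finset.range K, x n = 0 := by
    intro K
    induction K with
    | zero => intro m _; simp [hx m]
    | succ K ih =>
      intro m hm
      refine le_antisymm ?_ (le_inf (hx m) (hs _))
      rw [Finset.sum_range_succ]
      refine (inf_add_le_add_inf (hx m) (hs K) (hx K)).trans ?_
      rw [ih m (by omega), inf_comm, h K m (by omega), add_zero]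
  induction K with
  | zero => simpa using hb
  | succ K ih =>
    have := inf_add_sup (x K) (∑ n ∈ Finset.range K, x n)
    rw [key K K le_rfl, zero_add] at this
    rw [Finset.sum_range_succ, add_comm, ← this]
    exact sup_le (hxb K) ih

theorem unitComponent_nonneg (y : A) : 0 ≤ unitComponent y := by
  have := (isLUB_unitComponent y).1 ⟨0, rfl⟩
  simpa [zero_le_one' (A := A)] using this

theorem unitComponent_mono {x y : A} (h : x ≤ y) : unitComponent x ≤ unitComponent y := by
  refine (isLUB_unitComponent x).2 ?_
  rintro _ ⟨k, rfl⟩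
  exact (inf_le_inf_right 1 (nsmul_le_nsmul_right h k)).trans
    ((isLUB_unitComponent y).1 ⟨k, rfl⟩)

theorem unitComponent_inf_eq_zero {y c : A} (h : y ⊓ c = 0) : unitComponent y ⊓ c = 0 := by
  have hy : 0 ≤ y := h ▸ inf_le_left
  have hc : 0 ≤ c := h ▸ inf_le_right
  exact inf_eq_zero_of_isLUB (isLUB_unitComponent y) (unitComponent_nonneg y) hc fun k =>
    inf_eq_zero_of_le (nsmul_inf_eq_zero h k)
      (le_inf (nsmul_nonneg hy k) zero_le_one') hc inf_le_left le_rfl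

theorem inf_one_sub_unitComponent {y : A} (hy : 0 ≤ y) : y ⊓ (1 - unitComponent y) = 0 := by
  refine le_antisymm ?_ (le_inf hy (sub_nonneg.2 (unitComponent_le_one y)))
  have : unitComponent y ≤ unitComponent y - y ⊓ (1 - unitComponent y) := by
    refine (isLUB_unitComponent y).2 ?_
    rintro _ ⟨k, rfl⟩
    refine le_sub_iff_add_le.2 (le_trans (le_inf ?_ ?_) ((isLUB_unitComponent y).1 ⟨k + 1, rfl⟩))
    · rw [succ_nsmul]
      exact add_le_add inf_le_left inf_le_left
    · exact (add_le_add ((isLUB_unitComponent y).1 ⟨k, rfl⟩) inf_le_right).trans (by simp)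
  simpa using this

theorem unitComponent_inf_one_sub {y : A} (hy : 0 ≤ y) :
    unitComponent y ⊓ (1 - unitComponent y) = 0 :=
  unitComponent_inf_eq_zero (inf_one_sub_unitComponent hy)

/-- The bands of the `(K • u - 1)⁺` exhaust `A`: an element `t` disjoint from all of them satisfies
`K • (u ⊓ t) ≤ 1` for every `K`. -/
theorem posPart_eq_zero_of_forall_inf {u t : A} (hu : IsWeakOrderUnit u) (ht : 0 ≤ t)
    (h : ∀ K : ℕ, t ⊓ (K • u - 1)⁺ = 0) : t = 0 := by
  refine hu.2 t ?_
  rw [abs_of_nonneg ht]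
  refine le_antisymm ?_ (le_inf hu.1 ht)
  refine nonpos_of_forall_nsmul_le (c := 1) fun K => ?_
  calc K • (u ⊓ t) ≤ (K • t) ⊓ ((K • u - 1)⁺ + 1) := by
        refine le_inf (nsmul_le_nsmul_right inf_le_right K)
          ((nsmul_le_nsmul_right inf_le_left K).trans ?_)
        exact sub_le_iff_le_add.1 (le_posPart _)
    _ ≤ (K • t) ⊓ (K • u - 1)⁺ + (K • t) ⊓ 1 :=
        inf_add_le_add_inf (nsmul_nonneg ht K) (posPart_nonneg _) zero_le_one'
    _ ≤ 0 + 1 := add_le_add (nsmul_inf_eq_zero (h K) K).le inf_le_right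
    _ = 1 := zero_add 1

/-- On the band of `e n` one has `n • u ≥ 1`, and the partial sum `s` satisfies `s * u ≤ 1`, so `s`
is at most `n + 1` on the disjoint piece `d n` of `1`. The supremum of all `(n + 1) • d n` is
therefore a bound independent of `N`. -/
theorem exists_forall_geom_sum_le {w : A} (hw : 0 ≤ w) (hu : IsWeakOrderUnit (1 - w)) :
    ∃ b : A, ∀ N, ∑ i ∈ Finset.range N, w ^ i ≤ b := by
  set u := 1 - w with hu_def
  let e : ℕ → A := fun n => unitComponent (n • u - 1)⁺
  let d : ℕ → A := fun n => e (n + 1) - e n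
  have hx_mono : Monotone fun n : ℕ => (n • u - 1)⁺ := fun m n hmn =>
    posPart_mono (sub_le_sub_right (nsmul_le_nsmul_left hu.1 hmn) 1)
  have he_mono : Monotone e := fun m n hmn => unitComponent_mono (hx_mono hmn)
  have hd0 : ∀ n, 0 ≤ d n := fun n => sub_nonneg.2 (he_mono n.le_succ)
  have hd1 : ∀ n, d n ≤ e (n + 1) := fun n => sub_le_self _ (unitComponent_nonneg _)
  have hd2 : ∀ n, d n ≤ 1 - e n := fun n => sub_le_sub_right (unitComponent_le_one _) _
  have hdisj : ∀ m n, m < n → d m ⊓ d n = 0 := fun m n hmn =>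
    inf_eq_zero_of_le (unitComponent_inf_one_sub (posPart_nonneg (n • u - 1))) (hd0 m) (hd0 n)
      ((hd1 m).trans (he_mono hmn)) (hd2 n)
  let x : ℕ → A := fun n => (n + 1) • d n
  have hx0 : ∀ n, 0 ≤ x n := fun n => nsmul_nonneg (hd0 n) _
  have hxdisj : ∀ m n, m < n → x m ⊓ x n = 0 := fun m n hmn =>
    nsmul_inf_eq_zero (by rw [inf_comm]; exact nsmul_inf_eq_zero (by rw [inf_comm]; exact hdisj m n hmn) _) _
  obtain ⟨b, hb⟩ := laterally_complete (Set.range x) (Set.range_nonempty x)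
    (by rintro _ ⟨n, rfl⟩; exact hx0 n)
    (by
      rintro _ ⟨m, rfl⟩ _ ⟨n, rfl⟩ hmn
      rcases lt_trichotomy m n with h | h | h
      · exact hxdisj m n h
      · exact absurd (congrArg x h) hmn
      · rw [inf_comm]; exact hxdisj n m h)
  have hxb : ∀ n, x n ≤ b := fun n => hb.1 ⟨n, rfl⟩
  have hb0 : 0 ≤ b := (hx0 0).trans (hxb 0)
  refine ⟨b, fun N => ?_⟩
  set s := ∑ i ∈ Finset.range N, w ^ i with hs
  have hs0 : 0 ≤ s := Finset.sum_nonneg fun i _ => pow_nonneg hw i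
  have hw1 : w ≤ 1 := sub_nonneg.1 hu.1
  have hsN : s ≤ N := by
    have := Finset.sum_le_card_nsmul (Finset.range N) (fun i => w ^ i) 1
      fun i _ => pow_le_one₀ hw hw1
    simpa using this
  have hsu : s * u ≤ 1 := by
    rw [hs, hu_def, geom_sum_mul_neg]
    exact sub_le_self _ (pow_nonneg hw N)
  have hsd : ∀ n, s * d n ≤ x n := by
    intro n
    -- `d n` lies below `e (n + 1)`, which is disjoint from the negative part of `(n + 1) • u - 1`.
    have h1 : d n ≤ ((n + 1) • u) * d n := by
      have h2 : ((n + 1) • u - 1)⁻ * d n = 0 := by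
        refine mul_eq_zero_of_inf_eq_zero (inf_eq_zero_of_le (x := ((n + 1) • u - 1)⁻)
          (y := e (n + 1)) ?_ (negPart_nonneg _) (hd0 n) le_rfl (hd1 n))
        rw [inf_comm]
        exact unitComponent_inf_eq_zero (posPart_inf_negPart_eq_zero _)
      have h3 : 0 ≤ ((n + 1) • u - 1)⁺ * d n := mul_nonneg (posPart_nonneg _) (hd0 n)
      have h4 : 0 ≤ ((n + 1) • u - 1) * d n := by
        rw [← posPart_sub_negPart ((n + 1) • u - 1), sub_mul, h2, sub_zero]
        exact h3
      rw [sub_mul, one_mul] at h4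
      exact sub_nonneg.1 h4
    calc s * d n ≤ s * (((n + 1) • u) * d n) := mul_le_mul_of_nonneg_left h1 hs0
      _ = (n + 1) • ((s * u) * d n) := by
          rw [smul_mul_assoc, mul_smul_comm, mul_assoc]
      _ ≤ (n + 1) • (1 * d n) :=
          nsmul_le_nsmul_right (mul_le_mul_of_nonneg_right hsu (hd0 n)) _
      _ = x n := by rw [one_mul]
  have he0 : e 0 = 0 := by
    have h1 : ((0 : ℕ) • u - 1)⁺ = 0 := by
      rw [zero_nsmul, zero_sub]
      exact posPart_eq_zero.2 (neg_nonpos.2 zero_le_one')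
    refine le_antisymm ((isLUB_unitComponent _).2 ?_) (unitComponent_nonneg _)
    rintro _ ⟨k, rfl⟩
    simp only [h1, smul_zero]
    exact inf_le_left
  have hse : ∀ K, s * e K ≤ b := by
    intro K
    have h1 : e K = ∑ n ∈ Finset.range K, d n := by
      rw [Finset.sum_range_sub, he0, sub_zero]
    rw [h1, Finset.mul_sum]
    exact (Finset.sum_le_sum fun n _ => hsd n).trans
      (sum_le_of_pairwise_inf_eq_zero hx0 hb0 hxb hxdisj K)
  -- Since `s * e K ≤ b`, the excess of `s` over `b` lives on `1 - e K` for every `K`; the crude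
  -- bound `s ≤ N` suffices there.
  have ht : (s - b)⁺ = 0 := by
    refine posPart_eq_zero_of_forall_inf hu (posPart_nonneg _) fun K => ?_
    have hK : 0 ≤ 1 - e K := sub_nonneg.2 (unitComponent_le_one _)
    have h1 : (s - b)⁺ ≤ N * (1 - e K) := by
      refine sup_le ?_ (mul_nonneg (Nat.cast_nonneg N) hK)
      have h2 : s = s * e K + s * (1 - e K) := by rw [← mul_add]; simp
      rw [sub_le_iff_le_add, h2, add_comm]
      exact add_le_add (mul_le_mul_of_nonneg_right hsN hK) (hse K)
    refine inf_eq_zero_of_le (x := N * (1 - e K)) (y := (K • u - 1)⁺) ?_ (posPart_nonneg _)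
      (posPart_nonneg _) h1 le_rfl
    refine mul_left_disjoint _ _ _ (Nat.cast_nonneg N) ?_
    rw [inf_comm]
    exact inf_one_sub_unitComponent (posPart_nonneg _)
  exact sub_nonpos.1 (posPart_eq_zero.1 ht)

/-- If `1 - w` is a weak order unit, then it is invertible and its inverse is the sum of the
geometric series. -/
theorem exists_inverse_one_sub {w : A} (hw : 0 ≤ w) (hu : IsWeakOrderUnit (1 - w)) :
    IsUnit (1 - w) ∧ IsLUB (Set.range fun N => ∑ i ∈ Finset.range N, w ^ i)
      (Ring.inverse (1 - w)) := by
  obtain ⟨b, hb⟩ := exists_forall_geom_sum_le hw hu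
  have hlub := isLUB_csSup (Set.range_nonempty fun N => ∑ i ∈ Finset.range N, w ^ i)
    ⟨b, by rintro _ ⟨N, rfl⟩; exact hb N⟩
  set v := sSup (Set.range fun N => ∑ i ∈ Finset.range N, w ^ i)
  have hw1 : w ≤ 1 := sub_nonneg.1 hu.1
  have hu1 : 1 - w ≤ 1 := sub_le_self _ hw
  have hle : ∀ N, ∑ i ∈ Finset.range N, w ^ i ≤ v := fun N => hlub.1 ⟨N, rfl⟩
  have hpow : ∀ N, w ^ N ≤ v - ∑ i ∈ Finset.range N, w ^ i := fun N => by
    have := hle (N + 1)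
    rw [Finset.sum_range_succ, add_comm] at this
    exact le_sub_iff_add_le.2 this
  have small : ∀ y : A, (∀ N, y ≤ v - ∑ i ∈ Finset.range N, w ^ i) → y ≤ 0 := fun y hy => by
    have : v ≤ v - y := hlub.2 (by rintro _ ⟨N, rfl⟩; exact le_sub_comm.1 (hy N))
    simpa using this
  -- A squeeze: `y` lies between `1 - w ^ N` and `1 - w ^ N` plus the tail, and both `w ^ N` and the
  -- tail become small. It serves for `v * (1 - w)` and `(1 - w) * v` alike.
  have eq_one : ∀ y : A, (∀ N, y - (1 - w ^ N) ≤ v - ∑ i ∈ Finset.range N, w ^ i) →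
      (∀ N, 1 - w ^ N ≤ y) → y = 1 := fun y h1 h2 => by
    refine le_antisymm (sub_nonpos.1 (small _ fun N => ?_)) (sub_nonpos.1 (small _ fun N => ?_))
    · refine le_trans ?_ (h1 N)
      exact sub_le_sub_left (sub_le_self _ (pow_nonneg hw N)) y
    · exact (sub_le_comm.1 (h2 N)).trans (hpow N)
  have hvu : v * (1 - w) = 1 := by
    refine eq_one _ (fun N => ?_) fun N => ?_
    · rw [← geom_sum_mul_neg, ← sub_mul]
      exact mul_le_of_le_one_right (sub_nonneg.2 (hle N)) hu1
    · rw [← geom_sum_mul_neg]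
      exact mul_le_mul_of_nonneg_right (hle N) hu.1
  have huv : (1 - w) * v = 1 := by
    refine eq_one _ (fun N => ?_) fun N => ?_
    · rw [← mul_neg_geom_sum, ← mul_sub]
      exact mul_le_of_le_one_left (sub_nonneg.2 (hle N)) hu1
    · rw [← mul_neg_geom_sum]
      exact mul_le_mul_of_nonneg_left (hle N) hu.1
  refine ⟨⟨⟨1 - w, v, huv, hvu⟩, rfl⟩, ?_⟩
  have : Ring.inverse (1 - w) = v := Ring.inverse_unit ⟨1 - w, v, huv, hvu⟩
  rwa [this]

end UnivCompletePhiAlgebra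

/-! ### Order limits and domination of series. -/

section OrderConvergence

open UnivCompletePhiAlgebra VLComplexification

section

variable {A : Type*} [ConditionallyCompleteLattice A] [Ring A]

theorem DecreasesToZero.nonneg {p : ℕ → A} (hp : DecreasesToZero p) (n : ℕ) : 0 ≤ p n :=
  hp.2.1 ⟨n, rfl⟩

theorem decreasesToZero_of_antitone {p : ℕ → A} (hp : Antitone p) (h0 : ∀ n, 0 ≤ p n)
    (h : ∀ y, (∀ n, y ≤ p n) → y ≤ 0) : DecreasesToZero p :=
  ⟨hp, by rintro _ ⟨n, rfl⟩; exact h0 n, fun y hy => h y fun n => hy ⟨n, rfl⟩⟩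

end

variable {A : Type*} [ConditionallyCompleteLattice A] [Ring A] [Algebra ℝ A]
  [UnivCompletePhiAlgebra A]

theorem DecreasesToZero.le_of_forall_ge {p : ℕ → A} (hp : DecreasesToZero p) {y c : A} (m : ℕ)
    (h : ∀ n, m ≤ n → y ≤ c + p n) : y ≤ c := by
  refine sub_nonpos.1 (hp.2.2 ?_)
  rintro _ ⟨n, rfl⟩
  exact (sub_le_iff_le_add'.2 (h (max m n) (le_max_left _ _))).trans (hp.1 (le_max_right _ _))

theorem DecreasesToZero.le_of_forall {p : ℕ → A} (hp : DecreasesToZero p) {y c : A}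
    (h : ∀ n, y ≤ c + p n) : y ≤ c :=
  hp.le_of_forall_ge 0 fun n _ => h n

theorem DecreasesToZero.add {p q : ℕ → A} (hp : DecreasesToZero p) (hq : DecreasesToZero q) :
    DecreasesToZero fun n => p n + q n := by
  refine decreasesToZero_of_antitone (fun m n h => add_le_add (hp.1 h) (hq.1 h))
    (fun n => add_nonneg (hp.nonneg n) (hq.nonneg n)) fun y hy => ?_
  -- The two indices are decoupled: `p` is frozen at `m` while `q` goes to zero.
  refine hp.le_of_forall fun m => ?_
  rw [zero_add]
  exact hq.le_of_forall_ge m fun n hmn =>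
    (hy n).trans (add_le_add_left (hp.1 hmn) (q n))

theorem DecreasesToZero.nsmul {p : ℕ → A} (hp : DecreasesToZero p) (k : ℕ) :
    DecreasesToZero fun n => k • p n := by
  induction k with
  | zero => exact decreasesToZero_of_antitone (fun _ _ _ => by simp) (by simp) (by simp)
  | succ k ih => simpa only [succ_nsmul] using ih.add hp

/-- Where `(c - n)⁺` lives, `n ≤ c`; so `n • (c - n)⁺ ≤ c * (c - n)⁺ ≤ c * c`. -/
theorem nsmul_posPart_sub_natCast_le {c : A} (hc : 0 ≤ c) (n : ℕ) : n • (c - n)⁺ ≤ c * c := by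
  have h1 : (c - n)⁻ * (c - n)⁺ = 0 :=
    mul_eq_zero_of_inf_eq_zero (by rw [inf_comm]; exact posPart_inf_negPart_eq_zero _)
  have h2 : 0 ≤ (c - n) * (c - n)⁺ := by
    have : (c - n) * (c - n)⁺ = (c - n)⁺ * (c - n)⁺ := by
      conv_lhs => rw [← posPart_sub_negPart (c - n)]
      rw [sub_mul, posPart_sub_negPart, h1, sub_zero]
    rw [this]
    exact mul_nonneg (posPart_nonneg _) (posPart_nonneg _)
  have h3 : (c - n)⁺ ≤ c := sup_le (sub_le_self _ (Nat.cast_nonneg n)) hc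
  rw [sub_mul, ← nsmul_eq_mul] at h2
  exact (sub_nonneg.1 h2).trans (mul_le_mul_of_nonneg_left h3 hc)

theorem le_nsmul_one_add_posPart (c : A) (n : ℕ) : c ≤ n + (c - n)⁺ :=
  sub_le_iff_le_add'.1 (le_posPart _)

/-- The factor `c` need not be dominated by a multiple of `1`, so it is truncated at height `n`. The
truncated part times `p m` goes to zero, and the remainder `(c - n)⁺ * p 0` is removed by the
Archimedean property. -/
theorem DecreasesToZero.const_mul {p : ℕ → A} (hp : DecreasesToZero p) {c : A} (hc : 0 ≤ c) :
    DecreasesToZero fun n => c * p n := by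
  refine decreasesToZero_of_antitone (fun m n h => mul_le_mul_of_nonneg_left (hp.1 h) hc)
    (fun n => mul_nonneg hc (hp.nonneg n)) fun y hy => ?_
  refine nonpos_of_forall_nsmul_le (c := c * c * p 0) fun n => ?_
  have h1 : y ≤ (c - n)⁺ * p 0 := by
    refine (hp.nsmul n).le_of_forall fun m => (hy m).trans ?_
    have := mul_le_mul_of_nonneg_right (le_nsmul_one_add_posPart c n) (hp.nonneg m)
    rw [add_mul, ← nsmul_eq_mul, add_comm] at this
    exact this.trans (add_le_add_left
      (mul_le_mul_of_nonneg_left (hp.1 m.zero_le) (posPart_nonneg _)) _)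
  refine (nsmul_le_nsmul_right h1 n).trans ?_
  rw [← smul_mul_assoc]
  exact mul_le_mul_of_nonneg_right (nsmul_posPart_sub_natCast_le hc n) (hp.nonneg 0)

theorem DecreasesToZero.mul_const {p : ℕ → A} (hp : DecreasesToZero p) {c : A} (hc : 0 ≤ c) :
    DecreasesToZero fun n => p n * c := by
  refine decreasesToZero_of_antitone (fun m n h => mul_le_mul_of_nonneg_right (hp.1 h) hc)
    (fun n => mul_nonneg (hp.nonneg n) hc) fun y hy => ?_
  refine nonpos_of_forall_nsmul_le (c := p 0 * (c * c)) fun n => ?_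
  have h1 : y ≤ p 0 * (c - n)⁺ := by
    refine (hp.nsmul n).le_of_forall fun m => (hy m).trans ?_
    have := mul_le_mul_of_nonneg_left (le_nsmul_one_add_posPart c n) (hp.nonneg m)
    rw [mul_add, ← (Nat.cast_commute n (p m)).eq, ← nsmul_eq_mul, add_comm] at this
    exact this.trans (add_le_add_left
      (mul_le_mul_of_nonneg_right (hp.1 m.zero_le) (posPart_nonneg _)) _)
  refine (nsmul_le_nsmul_right h1 n).trans ?_
  rw [← mul_smul_comm]
  exact mul_le_mul_of_nonneg_left (nsmul_posPart_sub_natCast_le hc n) (hp.nonneg 0)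

/-- Every `X M - (β - B M)` lies below every `X N + (β - B N)`, so the supremum of the former is the
limit. -/
theorem exists_forall_abs_sub_le {X B : ℕ → A} {β : A} (hβ : ∀ N, B N ≤ β)
    (h : ∀ M N, M ≤ N → |X N - X M| ≤ B N - B M) : ∃ s, ∀ N, |X N - s| ≤ β - B N := by
  have hle : ∀ M N, X M - (β - B M) ≤ X N + (β - B N) := fun M N => by
    have h1 : |X M - X N| ≤ (β - B M) + (β - B N) := by
      rcases le_total M N with hMN | hNM
      · rw [abs_sub_comm]
        refine (h M N hMN).trans ((sub_le_sub_right (hβ N) _).trans ?_)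
        exact le_add_of_nonneg_right (sub_nonneg.2 (hβ N))
      · refine (h N M hNM).trans ((sub_le_sub_right (hβ M) _).trans ?_)
        exact le_add_of_nonneg_left (sub_nonneg.2 (hβ M))
    have h2 := (le_abs_self _).trans h1
    rw [sub_le_iff_le_add] at h2 ⊢
    refine h2.trans (le_of_eq ?_)
    abel
  have hl := isLUB_csSup (Set.range_nonempty fun M => X M - (β - B M))
    ⟨X 0 + (β - B 0), by rintro _ ⟨M, rfl⟩; exact hle M 0⟩
  refine ⟨sSup (Set.range fun M => X M - (β - B M)), fun N => abs_le'.2 ⟨?_, ?_⟩⟩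
  · exact sub_le_comm.1 (hl.1 ⟨N, rfl⟩)
  · rw [neg_sub, sub_le_iff_le_add']
    exact hl.2 (by rintro _ ⟨M, rfl⟩; exact hle M N)

/-- A series dominated by a series of positive elements with bounded partial sums converges in
order. -/
theorem exists_hasOrderSum_of_modulus_le {c : ℕ → VLComplexification A} {b : ℕ → A} {T : A}
    (hcb : ∀ n, (c n).modulus ≤ b n) (hT : ∀ N, ∑ n ∈ Finset.range N, b n ≤ T) :
    ∃ s, HasOrderSum c s := by
  let B : ℕ → A := fun m => ∑ n ∈ Finset.range (m + 1), b n
  have hb0 : ∀ n, 0 ≤ b n := fun n => (modulus_nonneg _).trans (hcb n)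
  have hlub := isLUB_csSup (Set.range_nonempty B) ⟨T, by rintro _ ⟨N, rfl⟩; exact hT (N + 1)⟩
  set β := sSup (Set.range B)
  have hBβ : ∀ N, B N ≤ β := fun N => hlub.1 ⟨N, rfl⟩
  have hmono : Monotone B := monotone_nat_of_le_succ fun n => by
    simp only [B, Finset.sum_range_succ _ (n + 1)]
    exact le_add_of_nonneg_right (hb0 _)
  have hp : DecreasesToZero fun N => β - B N :=
    decreasesToZero_of_antitone (fun m n h => sub_le_sub_left (hmono h) β)
      (fun N => sub_nonneg.2 (hBβ N)) fun y hy => by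
        have : β ≤ β - y := hlub.2 (by rintro _ ⟨N, rfl⟩; exact le_sub_comm.1 (hy N))
        simpa using this
  have cauchy : ∀ x : ℕ → A, (∀ n, |x n| ≤ b n) → ∀ M N, M ≤ N →
      |∑ n ∈ Finset.range (N + 1), x n - ∑ n ∈ Finset.range (M + 1), x n| ≤ B N - B M := by
    intro x hx M N hMN
    induction N, hMN using Nat.le_induction with
    | base => simp
    | succ N _ ih =>
      simp only [B, Finset.sum_range_succ _ (N + 1)] at ih ⊢
      rw [add_sub_right_comm, add_sub_right_comm]
      exact (abs_add_le _ _).trans (add_le_add ih (hx _))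
  obtain ⟨r, hr⟩ := exists_forall_abs_sub_le hBβ
    (cauchy (fun n => (c n).re) fun n => (abs_re_le_modulus _).trans (hcb n))
  obtain ⟨i, hi⟩ := exists_forall_abs_sub_le hBβ
    (cauchy (fun n => (c n).im) fun n => (abs_im_le_modulus _).trans (hcb n))
  refine ⟨⟨r, i⟩, _, hp.add hp, fun N => (modulus_le_abs_add_abs _).trans ?_⟩
  rw [sub_re, sub_im, re_sum, im_sum]
  exact add_le_add (hr N) (hi N)

theorem HasOrderSum.exists_modulus_le {a : ℕ → VLComplexification A} {s : VLComplexification A}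
    (h : HasOrderSum a s) : ∃ B : A, ∀ n, (a n).modulus ≤ B := by
  obtain ⟨p, hp, hps⟩ := h
  have hp0 := hp.nonneg 0
  -- Later terms are differences of two errors, giving `p 0 + p 0`; the term of index `0` is a
  -- single error plus `s`.
  refine ⟨p 0 + (p 0 + s.modulus), fun n => ?_⟩
  cases n with
  | zero =>
    have h1 := hps 0
    simp only [zero_add, Finset.sum_range_one] at h1
    have h2 := modulus_add_le (a 0 - s) s
    rw [sub_add_cancel] at h2
    exact (h2.trans (add_le_add_left h1 _)).trans (le_add_of_nonneg_left hp0)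
  | succ n =>
    have h1 : a (n + 1) = (∑ i ∈ Finset.range (n + 1 + 1), a i - s) -
        (∑ i ∈ Finset.range (n + 1), a i - s) := by
      rw [Finset.sum_range_succ _ (n + 1)]; abel
    rw [h1]
    refine (modulus_sub_le _ _).trans (add_le_add ((hps _).trans (hp.1 (Nat.zero_le _))) ?_)
    exact ((hps n).trans (hp.1 n.zero_le)).trans (le_add_of_nonneg_right (modulus_nonneg s))

/-- The negative part of `y - x` is disjoint from a weak order unit, hence zero. -/
theorem OrderLL.isWeakOrderUnit_sub {x y : A} (h : OrderLL x y) : IsWeakOrderUnit (y - x) := by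
  have h1 : (y - x)⁻ = 0 := h.2 _ (by
    rw [abs_of_nonneg (negPart_nonneg (y - x))]
    exact posPart_inf_negPart_eq_zero (y - x))
  have h2 : (y - x) ⊔ 0 = y - x := sup_of_le_left (negPart_eq_zero.1 h1)
  unfold OrderLL at h
  rwa [h2] at h

/-! ### Abel's estimate and the passage to the limit. -/

/-- Summation by parts for the partial sums of a power series. -/
theorem sum_mul_pow_sub_eq {R : Type*} [Ring R] (a : ℕ → R) (s z : R) (N : ℕ) :
    ∑ n ∈ Finset.range (N + 1), a n * z ^ n - s =
      ∑ n ∈ Finset.range (N + 1), (∑ i ∈ Finset.range (n + 1), a i - s) * ((1 - z) * z ^ n) +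
        (∑ i ∈ Finset.range (N + 1), a i - s) * z ^ (N + 1) := by
  induction N with
  | zero => simp; noncomm_ring
  | succ N ih =>
    rw [Finset.sum_range_succ, add_sub_right_comm, ih,
      Finset.sum_range_succ (fun n => (∑ i ∈ Finset.range (n + 1), a i - s) * _) (N + 1),
      Finset.sum_range_succ a (N + 1), pow_succ' z (N + 1)]
    noncomm_ring

/-- The estimate behind Abel's theorem: the distance of a partial sum of the power series at `z`
to the sum of the coefficients. -/
theorem modulus_sum_mul_pow_sub_le {a : ℕ → VLComplexification A} {s z : VLComplexification A}
    {p : ℕ → A} (hp : DecreasesToZero p)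
    (hps : ∀ m, (∑ n ∈ Finset.range (m + 1), a n - s).modulus ≤ p m)
    (hz : IsWeakOrderUnit (1 - z.modulus)) {M : A}
    (hM : (1 - z).modulus * Ring.inverse (1 - z.modulus) ≤ M) {m N : ℕ} (hmN : m ≤ N) :
    (∑ n ∈ Finset.range (N + 1), a n * z ^ n - s).modulus ≤
      m • (p 0 * (1 - z).modulus) + p m * M + p N := by
  have hw := modulus_nonneg z
  have hx := modulus_nonneg (1 - z)
  set w := z.modulus
  set x := (1 - z).modulus
  have hw1 : w ≤ 1 := sub_nonneg.1 hz.1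
  have hpow : ∀ n, w ^ n ≤ 1 := fun n => pow_le_one₀ hw hw1
  rw [sum_mul_pow_sub_eq]
  have hterm : ∀ n, ((∑ i ∈ Finset.range (n + 1), a i - s) * ((1 - z) * z ^ n)).modulus ≤
      p n * (x * w ^ n) := fun n => by
    refine (modulus_mul_le _ _).trans (mul_le_mul (hps n) ?_ (modulus_nonneg _) (hp.nonneg n))
    exact (modulus_mul_le _ _).trans (mul_le_mul_of_nonneg_left (modulus_pow_le z n) hx)
  have hxw : ∀ n, 0 ≤ x * w ^ n := fun n => mul_nonneg hx (pow_nonneg hw n)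
  refine (modulus_add_le _ _).trans (add_le_add ?_ ?_)
  · refine (modulus_sum_le _ _).trans ((Finset.sum_le_sum fun n _ => hterm n).trans ?_)
    rw [← Finset.sum_range_add_sum_Ico _ (by omega : m ≤ N + 1)]
    refine add_le_add ?_ ?_
    · have := Finset.sum_le_card_nsmul (Finset.range m) (fun n => p n * (x * w ^ n)) (p 0 * x)
        fun n _ => mul_le_mul (hp.1 n.zero_le) (mul_le_of_le_one_right hx (hpow n)) (hxw n)
          (hp.nonneg 0)
      simpa using this
    · calc ∑ n ∈ Finset.Ico m (N + 1), p n * (x * w ^ n)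
          ≤ ∑ n ∈ Finset.Ico m (N + 1), p m * (x * w ^ n) := Finset.sum_le_sum fun n hn =>
            mul_le_mul_of_nonneg_right (hp.1 (Finset.mem_Ico.1 hn).1) (hxw n)
        _ ≤ ∑ n ∈ Finset.range (N + 1), p m * (x * w ^ n) :=
            Finset.sum_le_sum_of_subset_of_nonneg
              (fun n hn => Finset.mem_range.2 (Finset.mem_Ico.1 hn).2)
              fun n _ _ => mul_nonneg (hp.nonneg m) (hxw n)
        _ = p m * (x * ∑ n ∈ Finset.range (N + 1), w ^ n) := by
            rw [Finset.mul_sum, Finset.mul_sum]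
        _ ≤ p m * (x * Ring.inverse (1 - w)) := mul_le_mul_of_nonneg_left
            (mul_le_mul_of_nonneg_left ((exists_inverse_one_sub hw hz).2.1 ⟨N + 1, rfl⟩) hx)
            (hp.nonneg m)
        _ ≤ p m * M := mul_le_mul_of_nonneg_left hM (hp.nonneg m)
  · refine (modulus_mul_le _ _).trans ?_
    refine (mul_le_mul (hps N) ((modulus_pow_le z _).trans (hpow _)) (modulus_nonneg _)
      (hp.nonneg N)).trans ?_
    rw [mul_one]

/-- A sequence dominated, for every `m`, by `m • q n + r m` with `q` and `r` decreasing to zero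
converges in order. -/
theorem orderTendsto_of_modulus_le {x : ℕ → VLComplexification A} {l : VLComplexification A}
    {q r : ℕ → A} (hq : DecreasesToZero q) (hr : DecreasesToZero r)
    (h : ∀ n m, (x n - l).modulus ≤ m • q n + r m) : OrderTendsto x l := by
  -- The dominating sequence is the supremum of each tail of errors. For fixed `m` it is at most `m
  -- • q k + r m`, so first `k` and then `m` goes to infinity.
  let T : ℕ → Set A := fun k => (fun n => (x n - l).modulus) '' Set.Ici k
  have hle : ∀ k m, ∀ y ∈ T k, y ≤ m • q k + r m := by
    rintro k m _ ⟨n, hn, rfl⟩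
    exact (h n m).trans (add_le_add_left (nsmul_le_nsmul_right (hq.1 hn) m) _)
  have hlub : ∀ k, IsLUB (T k) (sSup (T k)) := fun k =>
    isLUB_csSup ⟨_, k, Set.self_mem_Ici, rfl⟩ ⟨0 • q k + r 0, fun y hy => hle k 0 y hy⟩
  have hmem : ∀ k, (x k - l).modulus ≤ sSup (T k) := fun k => (hlub k).1 ⟨k, Set.self_mem_Ici, rfl⟩
  refine ⟨fun k => sSup (T k), decreasesToZero_of_antitone (fun j k hjk => ?_)
    (fun k => (modulus_nonneg _).trans (hmem k)) fun y hy => ?_, hmem⟩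
  · exact isLUB_le_iff (hlub k) |>.2 fun y hy =>
      (hlub j).1 (Set.image_mono (Set.Ici_subset_Ici.2 hjk) hy)
  · refine hr.le_of_forall fun m => ?_
    rw [zero_add]
    refine (hq.nsmul m).le_of_forall fun k => (hy k).trans ?_
    rw [add_comm]
    exact (hlub k).2 fun y hy => hle k m y hy

end OrderConvergence

open VLComplexification UnivCompletePhiAlgebra in
theorem proposition3p12 {A : Type*} [ConditionallyCompleteLattice A] [Ring A] [Algebra ℝ A]
    [UnivCompletePhiAlgebra A]
    (a : ℕ → VLComplexification A)
    (hradius : IsRadiusOfConvergence a (1 : A))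
    (hsum : ∃ s : VLComplexification A, HasOrderSum a s)
    (z : ℕ → VLComplexification A)
    (hz : OrderTendsto z 1)
    (hz_lt : ∀ k, OrderLL (z k).modulus (1 : A))
    (hz_bdd : OrderBounded
      (Set.range fun k => (1 - z k).modulus * Ring.inverse (1 - (z k).modulus))) :
    ∃ (S : ℕ → VLComplexification A) (S_e : VLComplexification A),
      (∀ k, HasOrderSum (fun n => a n * z k ^ n) (S k)) ∧
      HasOrderSum (fun n => a n * 1 ^ n) S_e ∧
      OrderTendsto S S_e := by
  obtain ⟨s, hs⟩ := hsum
  obtain ⟨B, hB⟩ := hs.exists_modulus_le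
  have hB0 : 0 ≤ B := (modulus_nonneg _).trans (hB 0)
  have hu : ∀ k, IsWeakOrderUnit (1 - (z k).modulus) := fun k => (hz_lt k).isWeakOrderUnit_sub
  have hS : ∀ k, ∃ S, HasOrderSum (fun n => a n * z k ^ n) S := fun k => by
    refine exists_hasOrderSum_of_modulus_le (b := fun n => B * (z k).modulus ^ n)
      (T := B * Ring.inverse (1 - (z k).modulus)) (fun n => ?_) fun N => ?_
    · exact (modulus_mul_le _ _).trans (mul_le_mul (hB n) (modulus_pow_le _ n)
        (modulus_nonneg _) hB0)
    · rw [← Finset.mul_sum]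
      exact mul_le_mul_of_nonneg_left
        ((exists_inverse_one_sub (modulus_nonneg _) (hu k)).2.1 ⟨N, rfl⟩) hB0
  choose S hS using hS
  refine ⟨S, s, hS, by simpa using hs, ?_⟩
  obtain ⟨p, hp, hps⟩ := hs
  obtain ⟨q, hq, hqz⟩ := hz
  obtain ⟨l, M, hM⟩ := hz_bdd
  have hMk : ∀ k, (1 - z k).modulus * Ring.inverse (1 - (z k).modulus) ≤ M :=
    fun k => (hM ⟨k, rfl⟩).2
  have hM0 : 0 ≤ M := by
    refine (mul_nonneg (modulus_nonneg (1 - z 0)) ?_).trans (hMk 0)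
    simpa using (exists_inverse_one_sub (modulus_nonneg _) (hu 0)).2.1 ⟨0, rfl⟩
  refine orderTendsto_of_modulus_le (hq.const_mul (hp.nonneg 0)) (hp.mul_const hM0) fun k m => ?_
  obtain ⟨δ, hδ, hδS⟩ := hS k
  -- `N` tends to infinity: the boundary term `p N` and the distance `δ N` of the partial sum to `S
  -- k` vanish together.
  refine (hp.add hδ).le_of_forall_ge m fun N hmN => ?_
  have h1 := modulus_sum_mul_pow_sub_le hp hps (hu k) (hMk k) hmN
  have h2 : (S k - s).modulus ≤ (∑ n ∈ Finset.range (N + 1), a n * z k ^ n - s).modulus +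
      (∑ n ∈ Finset.range (N + 1), a n * z k ^ n - S k).modulus := by
    refine le_trans (le_of_eq ?_) (modulus_sub_le _ _)
    congr 1
    abel
  refine (h2.trans (add_le_add h1 (hδS N))).trans ?_
  rw [add_assoc]
  refine add_le_add_left (add_le_add_left (nsmul_le_nsmul_right
    (mul_le_mul_of_nonneg_left ?_ (hp.nonneg 0)) m) _) _
  rw [modulus_sub_comm]
  exact hqz k
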